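/- For partitions $\mu\subseteq\lambda$, let $f^{\lambda/\mu}$ denote the number of standard Young tableaux of skew shape $\lambda/\mu$, i.e. the number of bijective fillings of the boxes of $\lambda/\mu$ with $1,2,\ldots,|\lambda/\mu|$ that increase along every row (left to right) and down every column. For $n\ge 1$ define the skew shapes $$\sigma_{3n-2}=(n,n,n-1,n-2,\ldots,3,2)/(n-2,n-3,\ldots,1,0),$$ $$\sigma_{3n-1}=(n,n,n,n-1,n-2,\ldots,3,2)/(n-1,n-2,\ldots,1,0),$$ $$\tau_{3n}=(n+1,n+1,n+1,n,n-1,\ldots,4,3)/(n,n-1,\ldots,1,0),$$ with $3n-2$, $3n-1$ and $3n$ boxes and with $n$, $n+1$ and $n+1$ rows, respectively; for small $n$ this means $\sigma_1=(1)$, $\sigma_4=(2,2)$, $\sigma_2=(1,1)$, $\sigma_5=(2,2,2)/(1)$, $\tau_3=(2,2)/(1)$, $\tau_6=(3,3,3)/(2,1)$. Then for every $n\ge 2$, $$f^{\sigma_{3n-2}}=\frac{1}{2n-1}\sum_{i=1}^{n-1}\binom{3n-2}{3i-1}f^{\sigma_{3i-1}}f^{\sigma_{3n-3i-1}},$$ $$f^{\tau_{3n}}=\frac{1}{2n+1}\sum_{i=1}^{n-1}\binom{3n}{3i}f^{\tau_{3i}}f^{\tau_{3n-3i}}.$$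 -/

import Mathlib

/-- A skew shape `λ/μ`: two Young diagrams with `μ` contained in `λ`. -/
structure SkewShape where
  outer : YoungDiagram
  inner : YoungDiagram
  inner_le : inner ≤ outer

/-- The boxes `(row, column)` of the skew diagram `λ/μ`. Rows are numbered from top to bottom and
columns from left to right, both from `0`. -/
def SkewShape.cells (S : SkewShape) : Finset (ℕ × ℕ) :=
  S.outer.cells \ S.inner.cells

/-- A standard Young tableau of skew shape `S`: a bijective filling of the boxes with
`1, 2, …, |S|` that increases along rows and columns. -/
structure StandardTableau (S : SkewShape) where
  entry : S.cells ≃ Finset.Icc 1 S.cells.card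
  row_lt : ∀ c d : S.cells, c.1.1 = d.1.1 → c.1.2 < d.1.2 → (entry c : ℕ) < (entry d : ℕ)
  col_lt : ∀ c d : S.cells, c.1.2 = d.1.2 → c.1.1 < d.1.1 → (entry c : ℕ) < (entry d : ℕ)

/-- `f^{λ/μ}`: the number of standard Young tableaux of shape `λ/μ`. -/
noncomputable def numTableaux (S : SkewShape) : ℕ :=
  Nat.card (StandardTableau S)

theorem entry_injective (S : SkewShape) :
    Function.Injective (StandardTableau.entry : StandardTableau S → _) := by
  rintro ⟨_, _, _⟩ ⟨_, _, _⟩ h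
  cases h
  rfl

/-- The count `numTableaux` is an honest one: there are finitely many tableaux. -/
instance (S : SkewShape) : Finite (StandardTableau S) :=
  Finite.of_injective _ (entry_injective S)

/-- The decreasing list `a + k - 1, …, a + 1, a` with `k` entries. -/
def descending (a k : ℕ) : List ℕ := (List.range' a k).reverse

theorem length_descending (a k : ℕ) : (descending a k).length = k := by
  simp [descending]

theorem getElem_descending (a k i : ℕ) (h : i < (descending a k).length) :
    (descending a k)[i] = a + (k - 1 - i) := by
  simp [descending]

theorem mem_descending {a k x : ℕ} : x ∈ descending a k ↔ a ≤ x ∧ x < a + k := by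
  simp [descending]

theorem sorted_descending (a k : ℕ) : (descending a k).SortedGE := by
  rw [List.sortedGE_iff_pairwise, descending, List.pairwise_reverse]
  exact (List.pairwise_lt_range' (s := a) (n := k)).imp fun h => le_of_lt h

theorem sorted_cons_descending (b a k : ℕ) (h : 0 < k → a + k ≤ b + 1) :
    (b :: descending a k).SortedGE := by
  rw [List.sortedGE_iff_pairwise, List.pairwise_cons]
  refine ⟨fun x hx => ?_, (sorted_descending a k).pairwise⟩
  have := mem_descending.1 hx
  omega

theorem sorted_cons_cons_descending (b a k : ℕ) (h : 0 < k → a + k ≤ b + 1) :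
    (b :: b :: descending a k).SortedGE := by
  rw [List.sortedGE_iff_pairwise, List.pairwise_cons]
  refine ⟨fun x hx => ?_, (sorted_cons_descending b a k h).pairwise⟩
  rcases List.mem_cons.1 hx with rfl | hx
  · exact le_rfl
  · have := mem_descending.1 hx
    omega

theorem ofRowLens_le {v w : List ℕ} (hv : v.SortedGE) (hw : w.SortedGE)
    (hlen : v.length ≤ w.length)
    (hle : ∀ (i : ℕ) (h₁ : i < v.length) (h₂ : i < w.length), v[i] ≤ w[i]) :
    YoungDiagram.ofRowLens v hv ≤ YoungDiagram.ofRowLens w hw := by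
  intro c hc
  obtain ⟨h₁, h₂⟩ := YoungDiagram.mem_ofRowLens.1 hc
  exact YoungDiagram.mem_ofRowLens.2
    ⟨h₁.trans_le hlen, h₂.trans_le (hle c.1 h₁ (h₁.trans_le hlen))⟩

/-- The shape `σ_{3n-2} = (n, n, n-1, …, 3, 2)/(n-2, n-3, …, 1, 0)`, for `n ≥ 1`.
It is `(1)` for `n = 1` and `(2, 2)` for `n = 2`. -/
def sigmaSubTwo (n : ℕ) : SkewShape where
  outer := YoungDiagram.ofRowLens (n :: descending 2 (n - 1))
    (sorted_cons_descending _ _ _ (by omega))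
  inner := YoungDiagram.ofRowLens (descending 0 (n - 1)) (sorted_descending _ _)
  inner_le := ofRowLens_le _ _ (by simp [length_descending]) (by
    rintro (_ | i) h₁ h₂ <;>
      simp only [List.length_cons, length_descending] at h₁ h₂ <;>
      simp only [List.getElem_cons_zero, List.getElem_cons_succ, getElem_descending] <;> omega)

/-- The shape `σ_{3n-1} = (n, n, n, n-1, …, 3, 2)/(n-1, n-2, …, 1, 0)`, for `n ≥ 1`.
It is `(1, 1)` for `n = 1` and `(2, 2, 2)/(1)` for `n = 2`. -/
def sigmaSubOne (n : ℕ) : SkewShape where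
  outer := YoungDiagram.ofRowLens (n :: n :: descending 2 (n - 1))
    (sorted_cons_cons_descending _ _ _ (by omega))
  inner := YoungDiagram.ofRowLens (descending 0 n) (sorted_descending _ _)
  inner_le := ofRowLens_le _ _ (by simp [length_descending]; omega) (by
    rintro (_ | _ | i) h₁ h₂ <;>
      simp only [List.length_cons, length_descending] at h₁ h₂ <;>
      simp only [List.getElem_cons_zero, List.getElem_cons_succ, getElem_descending] <;> omega)

/-- The shape `τ_{3n} = (n+1, n+1, n+1, n, …, 4, 3)/(n, n-1, …, 1, 0)`, for `n ≥ 1`.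
It is `(2, 2)/(1)` for `n = 1` and `(3, 3, 3)/(2, 1)` for `n = 2`. -/
def tauShape (n : ℕ) : SkewShape where
  outer := YoungDiagram.ofRowLens ((n + 1) :: (n + 1) :: descending 3 (n - 1))
    (sorted_cons_cons_descending _ _ _ (by omega))
  inner := YoungDiagram.ofRowLens (descending 0 (n + 1)) (sorted_descending _ _)
  inner_le := ofRowLens_le _ _ (by simp [length_descending]; omega) (by
    rintro (_ | _ | i) h₁ h₂ <;>
      simp only [List.length_cons, length_descending] at h₁ h₂ <;>
      simp only [List.getElem_cons_zero, List.getElem_cons_succ, getElem_descending] <;> omega)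

/-! Each shape consists of three consecutive antidiagonals, with middle boxes b₀, …, b_m (m = n -
1). Divided by the factorial of the number of boxes, the tableau count is the probability that
independent uniform variables on [0, 1] increase along rows and columns. Given the middle values,
the other boxes are independent: two neighbouring middle values x, y contribute min(x, y)(1 - max(x,
y)), the Green function of -d²/dx² with Dirichlet conditions, and an extra box at an end contributes
a factor b₀ or b_m. Hence the probability is the moment ∫ xᶜ Kᵐ xʳ of the Green operator K, with r,
c ∈ {0, 1} (`numTableaux_eq_greenMoment`).

With s = √t, solving the boundary value problem gives Σ tᵐ Kᵐ x = sin(sx)/sin s. The generating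
functions of the moments are W = 2 tan(s/2)/s for σ_{3n-2}, H = tan(s/2)/s for σ_{3n-1}, and T with
tT = 1 - s cot s for τ_{3n}. The Riccati equations for tan and cot (`riccati_of_relations`,
`riccati_of_relation`) yield both recurrences by comparing coefficients. -/

open MeasureTheory

/-! ### Linear orders and independent random variables. -/

theorem measurableSet_setOf_coord_lt {ι : Type*} [Fintype ι] (r : ι → ι → Prop) :
    MeasurableSet {x : ι → ℝ | ∀ i j, r i j → x i < x j} := by
  simp only [Set.ofPred_forall]
  exact MeasurableSet.iInter fun i => MeasurableSet.iInter fun j => MeasurableSet.iInter fun _ =>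
    measurableSet_lt (measurable_pi_apply i) (measurable_pi_apply j)

theorem prod_diagonal_null (μ : Measure ℝ) [IsProbabilityMeasure μ] [NullSingletonClass μ] :
    (μ.prod μ) {p | p.1 = p.2} = 0 := by
  rw [Measure.measure_prod_null (measurableSet_eq_fun measurable_fst measurable_snd)]
  refine Filter.Eventually.of_forall fun x => ?_
  simp [Set.preimage]

theorem pi_coord_eq_null {ι : Type*} [Fintype ι] (μ : Measure ℝ) [IsProbabilityMeasure μ]
    [NullSingletonClass μ] {i j : ι} (hij : i ≠ j) :
    Measure.pi (fun _ : ι => μ) {x | x i = x j} = 0 := by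
  have h := ProbabilityTheory.iIndepFun_pi (μ := fun _ : ι => μ) (X := fun _ x => x)
    (fun _ => aemeasurable_id)
  have h2 := (ProbabilityTheory.indepFun_iff_map_prod_eq_prod_map_map
    (measurable_pi_apply i).aemeasurable (measurable_pi_apply j).aemeasurable).1 (h.indepFun hij)
  rw [(measurePreserving_eval (fun _ : ι => μ) i).map_eq,
    (measurePreserving_eval (fun _ : ι => μ) j).map_eq] at h2
  have h3 := prod_diagonal_null μ
  rw [← h2, Measure.map_apply (by fun_prop) (measurableSet_eq_fun measurable_fst measurable_snd)]
    at h3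
  exact h3

theorem ae_injective_pi {ι : Type*} [Fintype ι] (μ : Measure ℝ) [IsProbabilityMeasure μ]
    [NullSingletonClass μ] :
    ∀ᵐ x ∂Measure.pi (fun _ : ι => μ), Function.Injective x := by
  have : ∀ᵐ x ∂Measure.pi (fun _ : ι => μ), ∀ i j, i ≠ j → x i ≠ x j := by
    rw [ae_all_iff]; intro i
    rw [ae_all_iff]; intro j
    by_cases hij : i = j
    · simp [hij]
    · have h := pi_coord_eq_null μ hij
      have : ∀ᵐ x ∂Measure.pi (fun _ : ι => μ), x i ≠ x j := by
        rw [ae_iff]; simpa using h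
      filter_upwards [this] with x hx _ using hx
  filter_upwards [this] with x hx i j hij
  by_contra hne
  exact hx i j hne hij

/-- The points whose coordinates are ordered by the linear order `e`. -/
def orderCell {ι L : Type*} [LT L] (e : ι ≃ L) : Set (ι → ℝ) :=
  {x | ∀ i j, e i < e j → x i < x j}

section

variable {ι L : Type*} [LinearOrder L]

theorem exists_mem_orderCell [Fintype ι] [Fintype L] (h : Fintype.card ι = Fintype.card L) {x : ι → ℝ}
    (hx : Function.Injective x) : ∃ e : ι ≃ L, x ∈ orderCell e := by
  let _ : LinearOrder ι := LinearOrder.lift' x hx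
  let e : ι ≃o L := (Fintype.orderIsoFinOfCardEq ι h).symm.trans
    (Fintype.orderIsoFinOfCardEq L rfl)
  refine ⟨e.toEquiv, fun i j hij => ?_⟩
  exact (e.lt_iff_lt (x := i) (y := j)).1 hij

theorem lt_iff_of_mem_orderCell {e : ι ≃ L} {x : ι → ℝ} (hx : x ∈ orderCell e) (i j : ι) :
    x i < x j ↔ e i < e j := by
  refine ⟨fun h => ?_, hx i j⟩
  by_contra hc
  rcases (not_lt.1 hc).eq_or_lt with h' | h'
  · exact h.ne (by rw [e.injective h'])
  · exact lt_asymm h (hx j i h')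

/-- A finite linear order has no order automorphism besides the identity. -/
theorem orderCell_disjoint [Fintype L] {e e' : ι ≃ L} {x : ι → ℝ} (hx : x ∈ orderCell e)
    (hx' : x ∈ orderCell e') : e = e' := by
  let f : L ≃ L := e.symm.trans e'
  have hf : StrictMono f := fun a b hab => by
    simp only [f, Equiv.trans_apply]
    rw [← lt_iff_of_mem_orderCell hx', lt_iff_of_mem_orderCell hx]
    simpa using hab
  have := Subsingleton.elim (hf.orderIsoOfSurjective f f.surjective) (OrderIso.refl L)
  ext i
  have h2 := DFunLike.congr_fun this (e i)
  simp only [StrictMono.coe_orderIsoOfSurjective, OrderIso.refl_apply] at h2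
  simpa [f] using h2.symm

theorem measurableSet_orderCell [Fintype ι] (e : ι ≃ L) : MeasurableSet (orderCell e) :=
  measurableSet_setOf_coord_lt _

theorem measure_orderCell_eq [Fintype ι] (μ : Measure ℝ) [IsProbabilityMeasure μ] (e e' : ι ≃ L) :
    Measure.pi (fun _ : ι => μ) (orderCell e) = Measure.pi (fun _ : ι => μ) (orderCell e') := by
  have h := measurePreserving_piCongrLeft (fun _ : ι => μ) (e.trans e'.symm)
  rw [← h.measure_preimage (measurableSet_orderCell e').nullMeasurableSet]
  congr 1
  ext x
  simp only [orderCell, Set.mem_preimage, Set.mem_ofPred_eq]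
  constructor
  · intro hx i j hij
    obtain ⟨i, rfl⟩ := (e.trans e'.symm).surjective i
    obtain ⟨j, rfl⟩ := (e.trans e'.symm).surjective j
    rw [MeasurableEquiv.coe_piCongrLeft]
    simp only [Equiv.piCongrLeft_apply_apply]
    exact hx i j (by simpa using hij)
  · intro hx i j hij
    have := hx ((e.trans e'.symm) i) ((e.trans e'.symm) j) (by simpa using hij)
    rw [MeasurableEquiv.coe_piCongrLeft] at this
    simpa only [Equiv.piCongrLeft_apply_apply] using this

/-- The probability that independent, identically distributed atomless random variables respect a
relation is the proportion of linear orders that do. -/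
theorem pi_setOf_coord_lt [Fintype ι] [Fintype L] (μ : Measure ℝ) [IsProbabilityMeasure μ] [NullSingletonClass μ]
    (h : Fintype.card ι = Fintype.card L) (r : ι → ι → Prop) :
    (Nat.card {e : ι ≃ L // ∀ i j, r i j → e i < e j} : ENNReal) =
      (Fintype.card ι).factorial *
        Measure.pi (fun _ : ι => μ) {x | ∀ i j, r i j → x i < x j} := by
  classical
  have key (s : Finset (ι ≃ L)) :
      Measure.pi (fun _ : ι => μ) (⋃ e ∈ s, orderCell e) =
        ∑ e ∈ s, Measure.pi (fun _ : ι => μ) (orderCell e) :=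
    measure_biUnion_finset (fun e _ e' _ hne => Set.disjoint_left.2 fun x hx hx' =>
      hne (orderCell_disjoint hx hx')) fun e _ => measurableSet_orderCell e
  obtain ⟨e₀⟩ := Fintype.card_eq.1 h
  have hsum (s : Finset (ι ≃ L)) :
      Measure.pi (fun _ : ι => μ) (⋃ e ∈ s, orderCell e) =
        s.card * Measure.pi (fun _ : ι => μ) (orderCell e₀) := by
    rw [key, Finset.sum_congr rfl fun e _ => measure_orderCell_eq μ e e₀, Finset.sum_const,
      nsmul_eq_mul]
  -- The cells are disjoint, equal in measure and cover every injective point, hence almost every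
  -- point.
  have hall : (Fintype.card ι).factorial * Measure.pi (fun _ : ι => μ) (orderCell e₀) = 1 := by
    rw [← Fintype.card_equiv e₀, ← Finset.card_univ, ← hsum,
      ← measure_univ (μ := Measure.pi (fun _ : ι => μ))]
    refine measure_congr ?_
    filter_upwards [ae_injective_pi μ] with x hx
    obtain ⟨e, he⟩ := exists_mem_orderCell h hx
    exact propext ⟨fun _ => trivial, fun _ => Set.mem_biUnion (Finset.mem_univ e) he⟩
  have hr : Measure.pi (fun _ : ι => μ) {x | ∀ i j, r i j → x i < x j} =
      Measure.pi (fun _ : ι => μ)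
        (⋃ e ∈ Finset.univ.filter fun e : ι ≃ L => ∀ i j, r i j → e i < e j, orderCell e) := by
    refine measure_congr ?_
    filter_upwards [ae_injective_pi μ] with x hx
    obtain ⟨e, he⟩ := exists_mem_orderCell h hx
    refine propext ⟨fun hxr => ?_, fun hxu => ?_⟩
    · refine Set.mem_biUnion (x := e) ?_ he
      simp only [Finset.coe_filter, Finset.mem_univ, true_and, Set.mem_ofPred_eq]
      exact fun i j hij => (lt_iff_of_mem_orderCell he i j).1 (hxr i j hij)
    · obtain ⟨e', he', hxe'⟩ := Set.mem_iUnion₂.1 hxu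
      exact fun i j hij => hxe' i j ((Finset.mem_filter.1 he').2 i j hij)
  rw [hr, hsum, mul_left_comm, hall, mul_one, Nat.card_eq_fintype_card, Fintype.card_subtype]

end

/-! ### Trigonometric power series in t = s² and their Riccati equations. -/

section
open PowerSeries

/-- The power series of `cos √t`. -/
noncomputable def cosSqrt : ℝ⟦X⟧ := mk fun k => (-1) ^ k / (2 * k).factorial

/-- The power series of `sin √t / √t`. -/
noncomputable def sincSqrt : ℝ⟦X⟧ := mk fun k => (-1) ^ k / (2 * k + 1).factorial

/-- The operator 2t d/dt equals s d/ds, so differentiation in s can be carried out on series in t,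
where it acts diagonally on coefficients. -/
theorem coeff_two_X_mul_derivative (f : ℝ⟦X⟧) (n : ℕ) :
    coeff n (2 * X * d⁄dX ℝ f) = 2 * n * coeff n f := by
  rw [mul_assoc, ← map_ofNat (C (R := ℝ)) 2, coeff_C_mul]
  cases n with
  | zero => simp
  | succ n => rw [coeff_succ_X_mul, coeff_derivative]; push_cast; ring

theorem derivative_cosSqrt : 2 * X * d⁄dX ℝ cosSqrt = -(X * sincSqrt) := by
  ext n
  rw [coeff_two_X_mul_derivative]
  cases n with
  | zero => simp
  | succ n =>
    rw [map_neg, coeff_succ_X_mul, cosSqrt, sincSqrt, coeff_mk, coeff_mk,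
      show 2 * (n + 1) = (2 * n + 1) + 1 by ring, Nat.factorial_succ]
    have : ((2 * n + 1).factorial : ℝ) ≠ 0 := by positivity
    push_cast
    field_simp
    ring

theorem derivative_sincSqrt : 2 * X * d⁄dX ℝ sincSqrt = cosSqrt - sincSqrt := by
  ext n
  rw [coeff_two_X_mul_derivative, map_sub, cosSqrt, sincSqrt, coeff_mk, coeff_mk,
    Nat.factorial_succ]
  have : ((2 * n).factorial : ℝ) ≠ 0 := by positivity
  push_cast
  field_simp
  ring

theorem cosSqrt_sq_add : cosSqrt ^ 2 + X * sincSqrt ^ 2 = 1 := by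
  have h : 2 * X * d⁄dX ℝ (cosSqrt ^ 2 + X * sincSqrt ^ 2) = 0 := by
    have h1 := derivative_cosSqrt
    have h2 := derivative_sincSqrt
    simp only [map_add, Derivation.leibniz, Derivation.leibniz_pow, smul_eq_mul, derivative_X,
      nsmul_eq_mul, Nat.cast_ofNat]
    simp only [Nat.add_one_sub_one, pow_one]
    linear_combination (2 * cosSqrt) * h1 + (2 * X * sincSqrt) * h2
  ext n
  cases n with
  | zero => simp [cosSqrt]
  | succ n =>
    have := congrArg (coeff (n + 1)) h
    rw [coeff_two_X_mul_derivative, map_zero] at this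
    have h3 : (2 * ((n + 1 : ℕ) : ℝ)) ≠ 0 := by positivity
    rw [(mul_eq_zero.1 this).resolve_left h3]
    simp [coeff_one]

theorem sincSqrt_ne_zero : sincSqrt ≠ 0 := fun h => by
  simpa [sincSqrt] using congrArg (coeff 0) h

theorem one_add_cosSqrt_ne_zero : 1 + cosSqrt ≠ 0 := fun h => by
  have := congrArg (coeff 0) h
  norm_num [cosSqrt] at this

theorem eq_two_mul_of_relations {W H : ℝ⟦X⟧} (h₁ : X * H * sincSqrt = 1 - cosSqrt)
    (h₂ : sincSqrt = W + (cosSqrt - 1) * H) : W = 2 * H := by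
  have h := cosSqrt_sq_add
  refine mul_left_cancel₀ (mul_ne_zero (X_ne_zero (R := ℝ)) sincSqrt_ne_zero) ?_
  linear_combination (-X * sincSqrt) * h₂ + (-1 - cosSqrt) * h₁ + h

/-- In terms of s, the left side is the derivative of sW = 2 tan(s/2), namely 1 + tan²(s/2). The
proof differentiates the half-angle identity `hH` to avoid division. -/
theorem riccati_of_relations {W H : ℝ⟦X⟧} (h₁ : X * H * sincSqrt = 1 - cosSqrt)
    (h₂ : sincSqrt = W + (cosSqrt - 1) * H) : 2 * X * d⁄dX ℝ W + W = 1 + X * H ^ 2 := by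
  have hW := eq_two_mul_of_relations h₁ h₂
  have hH : H * (1 + cosSqrt) = sincSqrt := by rw [hW] at h₂; linear_combination -h₂
  have hd := congrArg (d⁄dX ℝ) hH
  simp only [map_add, Derivation.leibniz, smul_eq_mul] at hd
  have hc := derivative_cosSqrt
  have hs := derivative_sincSqrt
  have h1 : d⁄dX ℝ (1 : ℝ⟦X⟧) = 0 := Derivation.map_one_eq_zero _
  have h2 : d⁄dX ℝ (2 * H) = 2 * d⁄dX ℝ H := by
    rw [two_mul, map_add, two_mul]
  rw [h1, zero_add] at hd
  refine mul_left_cancel₀ one_add_cosSqrt_ne_zero ?_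
  rw [hW, h2]
  linear_combination (4 * X) * hd - 2 * H * hc + 2 * hs + (2 - X * H) * hH + h₁

/-- Here XT stands for 1 - s cot s. -/
theorem riccati_of_relation {T : ℝ⟦X⟧} (h : X * T * sincSqrt = sincSqrt - cosSqrt) :
    2 * X * d⁄dX ℝ (X * T) + X * T = X + (X * T) ^ 2 := by
  set G := X * T
  have hd := congrArg (d⁄dX ℝ) h
  simp only [map_sub, Derivation.leibniz, smul_eq_mul] at hd
  have hc := derivative_cosSqrt
  have hs := derivative_sincSqrt
  refine mul_left_cancel₀ sincSqrt_ne_zero ?_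
  linear_combination (2 * X) * hd + (1 - G) * hs - hc + (1 - G) * h

end

/-! ### The Green operator on polynomials. -/

open Polynomial in
/-- The solution operator `p ↦ q` of `q'' = -p`, `q(0) = q(1) = 0`, on polynomials. -/
noncomputable def greenOp : ℝ[X] →ₗ[ℝ] ℝ[X] :=
  Polynomial.lsum fun k => LinearMap.toSpanSingleton ℝ ℝ[X]
    ((((k : ℝ) + 1) * (k + 2))⁻¹ • (X - X ^ (k + 2)))

open Polynomial in
/-- The integral of a polynomial over the unit interval. -/
noncomputable def unitIntegral : ℝ[X] →ₗ[ℝ] ℝ :=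
  Polynomial.lsum fun k => LinearMap.toSpanSingleton ℝ ℝ ((k : ℝ) + 1)⁻¹

section
open Polynomial

theorem greenOp_X_pow (k : ℕ) :
    greenOp (X ^ k) = (((k : ℝ) + 1) * (k + 2))⁻¹ • (X - X ^ (k + 2)) := by
  rw [greenOp, lsum_apply, X_pow_eq_monomial, sum_monomial_index _ _ (by simp)]
  simp

theorem unitIntegral_X_pow (k : ℕ) : unitIntegral (X ^ k) = ((k : ℝ) + 1)⁻¹ := by
  rw [unitIntegral, lsum_apply, X_pow_eq_monomial, sum_monomial_index _ _ (by simp)]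
  simp

theorem integral_eval_eq_unitIntegral (p : ℝ[X]) :
    ∫ x in (0 : ℝ)..1, p.eval x = unitIntegral p := by
  induction p using Polynomial.induction_on' with
  | add p q hp hq =>
    simp only [eval_add, map_add]
    rw [intervalIntegral.integral_add (p.continuous.intervalIntegrable _ _)
      (q.continuous.intervalIntegrable _ _), hp, hq]
  | monomial n a =>
    rw [← C_mul_X_pow_eq_monomial, ← smul_eq_C_mul, map_smul, unitIntegral_X_pow]
    simp [integral_pow]

theorem integral_green_pow {x : ℝ} (hx : x ∈ Set.Icc (0 : ℝ) 1) (k : ℕ) :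
    ∫ y in (0 : ℝ)..1, min y x * (1 - max y x) * y ^ k =
      (((k : ℝ) + 1) * (k + 2))⁻¹ * (x - x ^ (k + 2)) := by
  have hc : Continuous fun y : ℝ => min y x * (1 - max y x) * y ^ k := by fun_prop
  rw [← intervalIntegral.integral_add_adjacent_intervals (hc.intervalIntegrable 0 x)
    (hc.intervalIntegrable x 1)]
  -- The kernel is (1 - x)y below the diagonal and x(1 - y) above it.
  have h1 : ∫ y in (0 : ℝ)..x, min y x * (1 - max y x) * y ^ k =
      ∫ y in (0 : ℝ)..x, (1 - x) * y ^ (k + 1) :=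
    intervalIntegral.integral_congr fun y hy => by
      rw [Set.uIcc_of_le hx.1] at hy
      simp only [min_eq_left hy.2, max_eq_right hy.2]
      ring
  have h2 : ∫ y in x..1, min y x * (1 - max y x) * y ^ k =
      ∫ y in x..1, (x * y ^ k - x * y ^ (k + 1)) :=
    intervalIntegral.integral_congr fun y hy => by
      rw [Set.uIcc_of_le hx.2] at hy
      simp only [min_eq_right hy.1, max_eq_left hy.1]
      ring
  rw [h1, h2, intervalIntegral.integral_sub
    (Continuous.intervalIntegrable (by fun_prop) _ _)
    (Continuous.intervalIntegrable (by fun_prop) _ _)]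
  simp only [intervalIntegral.integral_const_mul, integral_pow]
  have h3 : (k : ℝ) + 1 ≠ 0 := by positivity
  have h4 : (k : ℝ) + 2 ≠ 0 := by positivity
  have h5 : (k : ℝ) + 1 + 1 ≠ 0 := by positivity
  push_cast
  field_simp
  ring

theorem integral_green_eval (p : ℝ[X]) {x : ℝ} (hx : x ∈ Set.Icc (0 : ℝ) 1) :
    ∫ y in (0 : ℝ)..1, min y x * (1 - max y x) * p.eval y = (greenOp p).eval x := by
  induction p using Polynomial.induction_on' with
  | add p q hp hq =>
    simp only [eval_add, map_add, mul_add]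
    rw [intervalIntegral.integral_add (Continuous.intervalIntegrable (by fun_prop) _ _)
      (Continuous.intervalIntegrable (by fun_prop) _ _), hp, hq]
  | monomial n a =>
    rw [← C_mul_X_pow_eq_monomial, ← smul_eq_C_mul, map_smul, greenOp_X_pow]
    simp only [eval_smul, eval_pow, eval_X, smul_eq_mul, eval_sub]
    rw [← integral_green_pow hx, ← intervalIntegral.integral_const_mul]
    exact intervalIntegral.integral_congr fun y _ => by ring

end

/-! ### Moments of the Green operator: generating functions and recurrences. -/

section
open PowerSeries

/-- The moments `∫ p · Kᵐ q` of the iterated Green operator `K`. -/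
noncomputable def greenMoment (p q : Polynomial ℝ) (m : ℕ) : ℝ :=
  unitIntegral ((greenOp^[m] q) * p)

/-- Coefficient of tᵐ in sin(sx)/s = (sin s/s) Σ tᵏ Kᵏ x. The function y = sin(sx)/s satisfies y'' =
-ty, so y = tKy + y(1)x; iterating gives the series. -/
theorem sinc_smul_X_pow_eq_sum (m : ℕ) :
    coeff m sincSqrt • (Polynomial.X : Polynomial ℝ) ^ (2 * m + 1) =
      ∑ a ∈ Finset.HasAntidiagonal.antidiagonal m, coeff a.1 sincSqrt • greenOp^[a.2] Polynomial.X := by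
  induction m with
  | zero => simp
  | succ m ih =>
    rw [Finset.Nat.sum_antidiagonal_succ']
    simp only [Function.iterate_succ_apply', ← map_smul]
    rw [← map_sum, ← ih, map_smul, greenOp_X_pow, smul_smul, smul_sub]
    have h : coeff m sincSqrt * ((((2 * m + 1 : ℕ) : ℝ) + 1) * ((2 * m + 1 : ℕ) + 2))⁻¹ =
        -coeff (m + 1) sincSqrt := by
      simp only [sincSqrt, coeff_mk]
      rw [show 2 * (m + 1) + 1 = (2 * m + 1) + 1 + 1 by ring,
        Nat.factorial_succ (2 * m + 1 + 1), Nat.factorial_succ (2 * m + 1)]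
      have : ((2 * m + 1).factorial : ℝ) ≠ 0 := by positivity
      push_cast
      field_simp
      ring
    rw [h, show 2 * (m + 1) + 1 = 2 * m + 1 + 2 by ring]
    simp only [Function.iterate_zero, id_eq, neg_smul]
    abel

/-- Same argument for y = cos(sx), whose linear interpolant between its boundary values is 1 + (cos
s - 1)x. -/
theorem cos_smul_X_pow_eq_sum (m : ℕ) :
    coeff m cosSqrt • (Polynomial.X : Polynomial ℝ) ^ (2 * m) = greenOp^[m] 1 +
      ∑ a ∈ Finset.HasAntidiagonal.antidiagonal m, coeff a.1 (cosSqrt - 1) • greenOp^[a.2] Polynomial.X := by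
  induction m with
  | zero => simp [cosSqrt]
  | succ m ih =>
    rw [Finset.Nat.sum_antidiagonal_succ']
    simp only [Function.iterate_succ_apply', ← map_smul]
    rw [← map_sum, add_left_comm, ← map_add, ← ih, map_smul, greenOp_X_pow, smul_smul, smul_sub]
    have h : coeff m cosSqrt * ((((2 * m : ℕ) : ℝ) + 1) * ((2 * m : ℕ) + 2))⁻¹ =
        -coeff (m + 1) cosSqrt := by
      simp only [cosSqrt, coeff_mk]
      rw [show 2 * (m + 1) = 2 * m + 1 + 1 by ring, Nat.factorial_succ,
        Nat.factorial_succ]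
      have : ((2 * m).factorial : ℝ) ≠ 0 := by positivity
      push_cast
      field_simp
      ring
    rw [h, show 2 * (m + 1) = 2 * m + 2 by ring]
    simp [coeff_one]

/-- The expansion of sin(sx)/s integrated against `p`; taking `p` to be 1 and x produces the closed
forms of H and T. -/
theorem mk_greenMoment_mul_sincSqrt (p : Polynomial ℝ) (m : ℕ) :
    coeff m (mk (greenMoment p Polynomial.X) * sincSqrt) =
      coeff m sincSqrt * unitIntegral (Polynomial.X ^ (2 * m + 1) * p) := by
  rw [mul_comm, coeff_mul, ← smul_eq_mul, ← map_smul, ← smul_mul_assoc, sinc_smul_X_pow_eq_sum,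
    Finset.sum_mul, map_sum]
  simp [greenMoment]

theorem X_mul_mk_greenMoment_one_X :
    X * mk (greenMoment 1 Polynomial.X) * sincSqrt = 1 - cosSqrt := by
  ext n
  cases n with
  | zero => simp [mul_assoc, cosSqrt]
  | succ m =>
    rw [mul_assoc, coeff_succ_X_mul, mk_greenMoment_mul_sincSqrt, mul_one, unitIntegral_X_pow]
    simp only [cosSqrt, sincSqrt, map_sub, coeff_mk, coeff_one]
    rw [show 2 * (m + 1) = 2 * m + 1 + 1 by ring, Nat.factorial_succ (2 * m + 1)]
    have : ((2 * m + 1).factorial : ℝ) ≠ 0 := by positivity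
    simp only [Nat.add_eq_zero_iff, one_ne_zero, and_false, if_false]
    push_cast
    field_simp
    ring

theorem X_mul_mk_greenMoment_X_X :
    X * mk (greenMoment Polynomial.X Polynomial.X) * sincSqrt = sincSqrt - cosSqrt := by
  ext n
  cases n with
  | zero => simp [mul_assoc, cosSqrt, sincSqrt]
  | succ m =>
    rw [mul_assoc, coeff_succ_X_mul, mk_greenMoment_mul_sincSqrt, ← pow_succ, unitIntegral_X_pow]
    simp only [cosSqrt, sincSqrt, map_sub, coeff_mk]
    rw [show 2 * (m + 1) = 2 * m + 1 + 1 by ring, Nat.factorial_succ (2 * m + 1 + 1),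
      Nat.factorial_succ (2 * m + 1)]
    have : ((2 * m + 1).factorial : ℝ) ≠ 0 := by positivity
    push_cast
    field_simp
    ring

theorem sincSqrt_eq_mk_greenMoment :
    sincSqrt = mk (greenMoment 1 1) + (cosSqrt - 1) * mk (greenMoment 1 Polynomial.X) := by
  ext m
  have h := congrArg unitIntegral (cos_smul_X_pow_eq_sum m)
  rw [map_smul, unitIntegral_X_pow, map_add, map_sum] at h
  simp only [map_smul] at h
  rw [map_add, coeff_mul]
  simp only [coeff_mk, greenMoment, mul_one]
  simp only [smul_eq_mul] at h
  rw [← h]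
  simp only [cosSqrt, sincSqrt, coeff_mk]
  rw [Nat.factorial_succ]
  have : ((2 * m).factorial : ℝ) ≠ 0 := by positivity
  push_cast
  field_simp

theorem greenMoment_one_one_recurrence (n : ℕ) :
    (2 * n + 3 : ℝ) * greenMoment 1 1 (n + 1) =
      ∑ a ∈ Finset.HasAntidiagonal.antidiagonal n,
        greenMoment 1 Polynomial.X a.1 * greenMoment 1 Polynomial.X a.2 := by
  have h := congrArg (coeff (n + 1))
    (riccati_of_relations X_mul_mk_greenMoment_one_X sincSqrt_eq_mk_greenMoment)
  rw [map_add, map_add, coeff_two_X_mul_derivative, coeff_succ_X_mul, sq, coeff_mul] at h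
  simp only [coeff_mk, coeff_one, Nat.add_eq_zero_iff, one_ne_zero, and_false, if_false,
    zero_add] at h
  rw [← h]
  push_cast
  ring

theorem greenMoment_X_X_recurrence (n : ℕ) :
    (2 * n + 5 : ℝ) * greenMoment Polynomial.X Polynomial.X (n + 1) =
      ∑ a ∈ Finset.HasAntidiagonal.antidiagonal n,
        greenMoment Polynomial.X Polynomial.X a.1 * greenMoment Polynomial.X Polynomial.X a.2 := by
  -- The Riccati equation concerns XT, so the moment of index n + 1 sits at degree n + 2, whence the
  -- factor 2(n + 2) + 1.
  have h := congrArg (coeff (n + 2)) (riccati_of_relation X_mul_mk_greenMoment_X_X)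
  rw [map_add, map_add, coeff_two_X_mul_derivative, mul_pow, sq X, mul_assoc X X,
    coeff_succ_X_mul, coeff_succ_X_mul, coeff_succ_X_mul, sq, coeff_mul] at h
  simp only [coeff_mk, coeff_X, Nat.reduceEqDiff, if_false, zero_add] at h
  rw [← h]
  push_cast
  ring

end

/-! ### Integrating out the outer levels, then the chain of middle variables. -/

/-- Fubini over the middle level `B`: each slice is a product of half-lines. The two neighbours of a
point may coincide, which covers end boxes with a single neighbour. -/
theorem pi_setOf_levels {A B C : Type*} [Fintype A] [Fintype B] [Fintype C] (μ : Measure ℝ)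
    [IsProbabilityMeasure μ] (l r : A → B) (l' r' : C → B) :
    Measure.pi (fun _ : B ⊕ (A ⊕ C) => μ)
        {x | (∀ a, x (.inr (.inl a)) < x (.inl (l a)) ∧ x (.inr (.inl a)) < x (.inl (r a))) ∧
          ∀ c, x (.inl (l' c)) < x (.inr (.inr c)) ∧ x (.inl (r' c)) < x (.inr (.inr c))} =
      ∫⁻ b : B → ℝ, (∏ a, μ (Set.Iio (min (b (l a)) (b (r a))))) *
        ∏ c, μ (Set.Ioi (max (b (l' c)) (b (r' c)))) ∂Measure.pi fun _ => μ := by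
  have h := measurePreserving_sumPiEquivProdPi (fun _ : B ⊕ (A ⊕ C) => μ)
  set S : Set ((B → ℝ) × (A ⊕ C → ℝ)) :=
    {p | (∀ a, p.2 (.inl a) < p.1 (l a) ∧ p.2 (.inl a) < p.1 (r a)) ∧
      ∀ c, p.1 (l' c) < p.2 (.inr c) ∧ p.1 (r' c) < p.2 (.inr c)} with hS
  have hmS : MeasurableSet S := by
    simp only [hS, Set.ofPred_and, Set.ofPred_forall]
    refine MeasurableSet.inter
      (MeasurableSet.iInter fun a => MeasurableSet.inter ?_ ?_)
      (MeasurableSet.iInter fun c => MeasurableSet.inter ?_ ?_) <;>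
    exact measurableSet_lt (by fun_prop) (by fun_prop)
  have h2 := h.measure_preimage hmS.nullMeasurableSet
  rw [Measure.prod_apply hmS] at h2
  refine h2.trans (lintegral_congr fun b => ?_)
  have : Prod.mk b ⁻¹' S = Set.univ.pi (Sum.elim (fun a => Set.Iio (min (b (l a)) (b (r a))))
      fun c => Set.Ioi (max (b (l' c)) (b (r' c)))) := by
    ext y
    simp [hS, Set.mem_pi]
  rw [this, Measure.pi_pi, Fintype.prod_sum_type]
  simp

/-- Integrating out b₀ replaces `f` by its image under the kernel operator and shortens the chain by
one; hence `f` is quantified inside the induction. -/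
theorem lintegral_pi_chain (μ : Measure ℝ) [IsProbabilityMeasure μ] {k : ℝ → ℝ → ENNReal}
    (hk : Measurable (Function.uncurry k)) {g : ℝ → ENNReal} (hg : Measurable g) (m : ℕ) :
    ∀ {f : ℝ → ENNReal}, Measurable f →
    ∫⁻ b : Fin (m + 1) → ℝ, f (b 0) * (∏ i : Fin m, k (b i.castSucc) (b i.succ)) *
        g (b (Fin.last m)) ∂Measure.pi (fun _ => μ) =
      ∫⁻ x, (fun f y => ∫⁻ x, f x * k x y ∂μ)^[m] f x * g x ∂μ := by
  have hk' {α : Type} [MeasurableSpace α] {u v : α → ℝ} (hu : Measurable u) (hv : Measurable v) :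
      Measurable fun a => k (u a) (v a) := hk.comp (hu.prodMk hv)
  induction m with
  | zero =>
    intro f hf
    simpa using (measurePreserving_eval (fun _ : Fin 1 => μ) 0).lintegral_comp (hf.mul hg)
  | succ m ih =>
    intro f hf
    have hTf : Measurable fun y => ∫⁻ x, f x * k x y ∂μ :=
      Measurable.lintegral_prod_left' (f := fun p : ℝ × ℝ => f p.1 * k p.1 p.2)
        ((hf.comp measurable_fst).mul (hk' measurable_fst measurable_snd))
    rw [Function.iterate_succ_apply, ← ih hTf,
      ← (measurePreserving_piFinSuccAbove (fun _ : Fin (m + 2) => μ) 0).symm.lintegral_comp_emb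
        (MeasurableEquiv.measurableEmbedding _), lintegral_prod_symm]
    · refine lintegral_congr fun b => ?_
      have hfk : Measurable fun x => f x * k x (b 0) := hf.mul (hk' measurable_id measurable_const)
      rw [mul_assoc, ← lintegral_mul_const _ hfk]
      refine lintegral_congr fun x => ?_
      rw [Fin.prod_univ_succ]
      simp only [MeasurableEquiv.piFinSuccAbove_symm_apply, Fin.insertNthEquiv_zero,
        Fin.consEquiv_apply, Fin.castSucc_zero, Fin.cons_zero, Fin.cons_succ,
        ← Fin.succ_castSucc, ← Fin.succ_last]
      ring
    · have hF : Measurable fun b : Fin (m + 2) → ℝ =>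
          f (b 0) * (∏ i : Fin (m + 1), k (b i.castSucc) (b i.succ)) * g (b (Fin.last (m + 1))) :=
        ((hf.comp (measurable_pi_apply _)).mul (Finset.measurable_prod _ fun i _ =>
          hk' (measurable_pi_apply _) (measurable_pi_apply _))).mul
            (hg.comp (measurable_pi_apply _))
      exact (hF.comp (MeasurableEquiv.measurable _)).aemeasurable

/-! ### The Green kernel as a probability on the unit interval. -/

/-- Lebesgue measure on the unit interval. -/
noncomputable def unitMeasure : Measure ℝ := volume.restrict (Set.Icc 0 1)

instance : IsProbabilityMeasure unitMeasure := ⟨by simp [unitMeasure]⟩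

instance : NullSingletonClass unitMeasure := by unfold unitMeasure; infer_instance

theorem ae_unitMeasure_mem : ∀ᵐ x ∂unitMeasure, x ∈ Set.Icc (0 : ℝ) 1 :=
  ae_restrict_mem measurableSet_Icc

theorem unitMeasure_Iio {x : ℝ} (hx : x ∈ Set.Icc (0 : ℝ) 1) :
    unitMeasure (Set.Iio x) = ENNReal.ofReal x := by
  rw [unitMeasure, Measure.restrict_apply measurableSet_Iio]
  have : Set.Iio x ∩ Set.Icc 0 1 = Set.Ico 0 x := by
    ext y
    simp only [Set.mem_inter_iff, Set.mem_Iio, Set.mem_Icc, Set.mem_Ico]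
    have := hx.2
    constructor
    · rintro ⟨h, h', -⟩; exact ⟨h', h⟩
    · rintro ⟨h, h'⟩; exact ⟨h', h, by linarith⟩
  rw [this, Real.volume_Ico, sub_zero]

theorem unitMeasure_Ioi {x : ℝ} (hx : x ∈ Set.Icc (0 : ℝ) 1) :
    unitMeasure (Set.Ioi x) = ENNReal.ofReal (1 - x) := by
  rw [unitMeasure, Measure.restrict_apply measurableSet_Ioi]
  have : Set.Ioi x ∩ Set.Icc 0 1 = Set.Ioc x 1 := by
    ext y
    simp only [Set.mem_inter_iff, Set.mem_Ioi, Set.mem_Icc, Set.mem_Ioc]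
    have := hx.1
    constructor
    · rintro ⟨h, -, h'⟩; exact ⟨h, h'⟩
    · rintro ⟨h, h'⟩; exact ⟨h, by linarith, h'⟩
  rw [this, Real.volume_Ioc]

theorem integral_unitMeasure (f : ℝ → ℝ) :
    ∫ x, f x ∂unitMeasure = ∫ x in (0 : ℝ)..1, f x := by
  rw [unitMeasure, integral_Icc_eq_integral_Ioc, intervalIntegral.integral_of_le zero_le_one]

theorem lintegral_unitMeasure_ofReal {f : ℝ → ℝ} (hf : Continuous f)
    (h0 : ∀ x ∈ Set.Icc (0 : ℝ) 1, 0 ≤ f x) :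
    ∫⁻ x, ENNReal.ofReal (f x) ∂unitMeasure = ENNReal.ofReal (∫ x in (0 : ℝ)..1, f x) := by
  rw [← integral_unitMeasure, ofReal_integral_eq_lintegral_ofReal]
  · exact hf.continuousOn.integrableOn_compact isCompact_Icc
  · filter_upwards [ae_unitMeasure_mem] with x hx using h0 x hx

/-- The kernel `min (x, y) (1 - max (x, y))` as a product of probabilities. -/
noncomputable def greenKernel (x y : ℝ) : ENNReal :=
  unitMeasure (Set.Iio (min x y)) * unitMeasure (Set.Ioi (max x y))

theorem measurable_measure_Iio (μ : Measure ℝ) : Measurable fun x => μ (Set.Iio x) :=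
  Monotone.measurable fun _ _ h => measure_mono (Set.Iio_subset_Iio h)

theorem measurable_measure_Ioi (μ : Measure ℝ) : Measurable fun x => μ (Set.Ioi x) :=
  Antitone.measurable fun _ _ h => measure_mono (Set.Ioi_subset_Ioi h)

theorem measurable_greenKernel : Measurable (Function.uncurry greenKernel) :=
  ((measurable_measure_Iio _).comp (measurable_fst.min measurable_snd)).mul
    ((measurable_measure_Ioi _).comp (measurable_fst.max measurable_snd))

theorem greenKernel_eq_ofReal {x y : ℝ} (hx : x ∈ Set.Icc (0 : ℝ) 1) (hy : y ∈ Set.Icc (0 : ℝ) 1) :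
    greenKernel x y = ENNReal.ofReal (min x y * (1 - max x y)) := by
  have hmin : min x y ∈ Set.Icc (0 : ℝ) 1 := ⟨le_min hx.1 hy.1, (min_le_left _ _).trans hx.2⟩
  have hmax : max x y ∈ Set.Icc (0 : ℝ) 1 := ⟨hx.1.trans (le_max_left _ _), max_le hx.2 hy.2⟩
  rw [greenKernel, unitMeasure_Iio hmin, unitMeasure_Ioi hmax, ENNReal.ofReal_mul hmin.1]

theorem min_mul_one_sub_max_nonneg {x y : ℝ} (hx : x ∈ Set.Icc (0 : ℝ) 1)
    (hy : y ∈ Set.Icc (0 : ℝ) 1) : 0 ≤ min x y * (1 - max x y) :=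
  mul_nonneg (le_min hx.1 hy.1) (sub_nonneg.2 (max_le hx.2 hy.2))

section
open Polynomial

theorem greenOp_eval_nonneg {p : ℝ[X]} (hp : ∀ x ∈ Set.Icc (0 : ℝ) 1, 0 ≤ p.eval x) :
    ∀ x ∈ Set.Icc (0 : ℝ) 1, 0 ≤ (greenOp p).eval x := fun x hx => by
  rw [← integral_green_eval p hx]
  exact intervalIntegral.integral_nonneg zero_le_one fun y hy =>
    mul_nonneg (min_mul_one_sub_max_nonneg hy hx) (hp y hy)

theorem greenOp_iterate_eval_nonneg {p : ℝ[X]} (hp : ∀ x ∈ Set.Icc (0 : ℝ) 1, 0 ≤ p.eval x)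
    (m : ℕ) : ∀ x ∈ Set.Icc (0 : ℝ) 1, 0 ≤ (greenOp^[m] p).eval x := by
  induction m with
  | zero => exact hp
  | succ m ih => rw [Function.iterate_succ_apply']; exact greenOp_eval_nonneg ih

/-- Nonnegativity on [0, 1] is what lets `ENNReal.ofReal` pass through each integral. -/
theorem lintegral_greenKernel_iterate {p : ℝ[X]} (hp : ∀ x ∈ Set.Icc (0 : ℝ) 1, 0 ≤ p.eval x)
    {f : ℝ → ENNReal} (hf : ∀ x ∈ Set.Icc (0 : ℝ) 1, f x = ENNReal.ofReal (p.eval x)) (m : ℕ) :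
    ∀ x ∈ Set.Icc (0 : ℝ) 1,
      (fun f y => ∫⁻ x, f x * greenKernel x y ∂unitMeasure)^[m] f x =
        ENNReal.ofReal ((greenOp^[m] p).eval x) := by
  induction m with
  | zero => exact hf
  | succ m ih =>
    intro y hy
    rw [Function.iterate_succ_apply', Function.iterate_succ_apply', ← integral_green_eval _ hy,
      ← lintegral_unitMeasure_ofReal (by fun_prop) fun x hx =>
        mul_nonneg (min_mul_one_sub_max_nonneg hx hy) (greenOp_iterate_eval_nonneg hp m x hx)]
    refine lintegral_congr_ae ?_
    filter_upwards [ae_unitMeasure_mem] with x hx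
    rw [ih x hx, greenKernel_eq_ofReal hx hy, mul_comm,
      ENNReal.ofReal_mul (min_mul_one_sub_max_nonneg hx hy)]

theorem lintegral_chain_eq_greenMoment (r c m : ℕ) :
    ∫⁻ b : Fin (m + 1) → ℝ, unitMeasure (Set.Iio (b 0)) ^ r *
        (∏ i : Fin m, greenKernel (b i.castSucc) (b i.succ)) *
        unitMeasure (Set.Iio (b (Fin.last m))) ^ c ∂Measure.pi (fun _ => unitMeasure) =
      ENNReal.ofReal (greenMoment (X ^ c) (X ^ r) m) := by
  have hX (n : ℕ) : ∀ x ∈ Set.Icc (0 : ℝ) 1, 0 ≤ (X ^ n : ℝ[X]).eval x := fun x hx => by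
    simpa using pow_nonneg hx.1 n
  have hI (n : ℕ) : ∀ x ∈ Set.Icc (0 : ℝ) 1,
      unitMeasure (Set.Iio x) ^ n = ENNReal.ofReal ((X ^ n : ℝ[X]).eval x) := fun x hx => by
    rw [unitMeasure_Iio hx, eval_pow, eval_X, ENNReal.ofReal_pow hx.1]
  rw [lintegral_pi_chain unitMeasure measurable_greenKernel
    ((measurable_measure_Iio unitMeasure).pow_const c) m
    ((measurable_measure_Iio unitMeasure).pow_const r), greenMoment,
    ← integral_eval_eq_unitIntegral]
  rw [← lintegral_unitMeasure_ofReal (Polynomial.continuous _) fun x hx => by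
    rw [eval_mul]
    exact mul_nonneg (greenOp_iterate_eval_nonneg (hX r) m x hx) (hX c x hx)]
  refine lintegral_congr_ae ?_
  filter_upwards [ae_unitMeasure_mem] with x hx
  rw [lintegral_greenKernel_iterate (hX r) (hI r) m x hx, hI c x hx, eval_mul,
    ENNReal.ofReal_mul (greenOp_iterate_eval_nonneg (hX r) m x hx)]

theorem greenMoment_X_pow_nonneg (r c m : ℕ) : 0 ≤ greenMoment (X ^ c) (X ^ r) m := by
  have hX (n : ℕ) : ∀ x ∈ Set.Icc (0 : ℝ) 1, 0 ≤ (X ^ n : ℝ[X]).eval x := fun x hx => by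
    simpa using pow_nonneg hx.1 n
  rw [greenMoment, ← integral_eval_eq_unitIntegral]
  refine intervalIntegral.integral_nonneg zero_le_one fun x hx => ?_
  rw [eval_mul]
  exact mul_nonneg (greenOp_iterate_eval_nonneg (hX r) m x hx) (hX c x hx)

end

/-! ### Tableaux on strips of three antidiagonals. -/

/-- The relation between two boxes of a row or of a column. -/
def boxLT (p q : ℕ × ℕ) : Prop := (p.1 = q.1 ∧ p.2 < q.2) ∨ (p.2 = q.2 ∧ p.1 < q.1)

theorem numTableaux_eq_card {ι : Type*} (S : SkewShape) (φ : ι ≃ S.cells) :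
    numTableaux S = Nat.card {e : ι ≃ Finset.Icc 1 S.cells.card //
      ∀ i j, boxLT (φ i) (φ j) → e i < e j} := by
  refine Nat.card_congr
    { toFun := fun t => ⟨φ.trans t.entry, fun i j hij => ?_⟩
      invFun := fun e => ⟨φ.symm.trans e.1, fun c d h h' => ?_, fun c d h h' => ?_⟩
      left_inv := fun t => entry_injective S (by ext; simp)
      right_inv := fun e => Subtype.ext (by ext; simp) }
  · rcases hij with ⟨h, h'⟩ | ⟨h, h'⟩
    · exact t.row_lt _ _ h h'
    · exact t.col_lt _ _ h h'
  · exact e.2 _ _ (Or.inl (by simpa using ⟨h, h'⟩))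
  · exact e.2 _ _ (Or.inr (by simpa using ⟨h, h'⟩))

/-- Index type for the boxes of a strip of three diagonals: the middle diagonal, the lower diagonal
(inner boxes, then end boxes), and the upper diagonal. -/
abbrev StripIndex (r c m : ℕ) : Type := Fin (m + 1) ⊕ ((Fin m ⊕ (Fin r ⊕ Fin c)) ⊕ Fin m)

/-- The boxes of a strip of three diagonals. -/
def stripBox (r c m : ℕ) : StripIndex r c m → ℕ × ℕ
  | .inl i => (r + i, m - i + c)
  | .inr (.inl (.inl i)) => (r + i, m - 1 - i + c)
  | .inr (.inl (.inr (.inl e))) => (e, m + c)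
  | .inr (.inl (.inr (.inr e))) => (r + m, e)
  | .inr (.inr i) => (r + i + 1, m - i + c)

/-- `S` consists of the boxes of an `(m + r + 1) × (m + c + 1)` rectangle on the three middle
antidiagonals. -/
def IsStrip (S : SkewShape) (r c m : ℕ) : Prop :=
  ∀ p : ℕ × ℕ, p ∈ S.cells ↔ p.1 ≤ m + r ∧ p.2 ≤ m + c ∧ m + r + c ≤ p.1 + p.2 + 1 ∧
    p.1 + p.2 + 1 ≤ m + r + c + 2

section

variable {S : SkewShape} {r c m : ℕ}

/-- With r, c ≤ 1 the only possible end boxes are (0, m + c) and (r + m, 0), which then lie on the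
lower antidiagonal. -/
theorem stripBox_mem (hr : r ≤ 1) (hc : c ≤ 1) (hS : IsStrip S r c m) (i : StripIndex r c m) :
    stripBox r c m i ∈ S.cells := by
  rw [hS]
  rcases i with i | (i | (i | i)) | i <;> simp only [stripBox] <;> omega

theorem stripBox_injective (hr : r ≤ 1) (hc : c ≤ 1) : Function.Injective (stripBox r c m) := by
  intro i j h
  rcases i with i | (i | (i | i)) | i <;> rcases j with j | (j | (j | j)) | j <;>
    simp only [stripBox, Prod.mk.injEq] at h <;>
    first
    | (exfalso; omega)
    | (simp only [Sum.inl.injEq, Sum.inr.injEq]; omega)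

theorem exists_stripBox_eq (hS : IsStrip S r c m) {p : ℕ × ℕ}
    (hp : p ∈ S.cells) : ∃ i, stripBox r c m i = p := by
  obtain ⟨x, y⟩ := p
  rw [hS] at hp
  simp only at hp
  obtain ⟨h1, h2, h3, h4⟩ := hp
  obtain h | h | h : x + y + 1 = m + r + c ∨ x + y + 1 = m + r + c + 1 ∨
      x + y + 1 = m + r + c + 2 := by omega
  · by_cases hx : x < r
    · exact ⟨.inr (.inl (.inr (.inl ⟨x, hx⟩))), Prod.ext rfl (by simp only [stripBox]; omega)⟩
    · by_cases hy : y < c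
      · exact ⟨.inr (.inl (.inr (.inr ⟨y, hy⟩))), Prod.ext (by simp only [stripBox]; omega) rfl⟩
      · exact ⟨.inr (.inl (.inl ⟨x - r, by omega⟩)), by simp only [stripBox, Prod.mk.injEq]; omega⟩
  · exact ⟨.inl ⟨x - r, by omega⟩, by simp only [stripBox, Prod.mk.injEq]; omega⟩
  · exact ⟨.inr (.inr ⟨x - r - 1, by omega⟩), by simp only [stripBox, Prod.mk.injEq]; omega⟩

/-- The boxes of a strip, indexed. -/
noncomputable def stripEquiv (hr : r ≤ 1) (hc : c ≤ 1) (hS : IsStrip S r c m) :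
    StripIndex r c m ≃ S.cells :=
  Equiv.ofBijective (fun i => ⟨stripBox r c m i, stripBox_mem hr hc hS i⟩)
    ⟨fun _ _ h => stripBox_injective hr hc (congrArg Subtype.val h), fun p =>
      let ⟨i, hi⟩ := exists_stripBox_eq hS p.2
      ⟨i, Subtype.ext hi⟩⟩

/-- First box of the middle diagonal next to a box of the lower diagonal. -/
def lowerFst : Fin m ⊕ (Fin r ⊕ Fin c) → Fin (m + 1) :=
  Sum.elim Fin.castSucc (Sum.elim (fun _ => 0) fun _ => Fin.last m)

/-- Second box of the middle diagonal next to a box of the lower diagonal. -/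
def lowerSnd : Fin m ⊕ (Fin r ⊕ Fin c) → Fin (m + 1) :=
  Sum.elim Fin.succ (Sum.elim (fun _ => 0) fun _ => Fin.last m)

/-- Boxes of one antidiagonal are never comparable, so only relations between neighbouring
antidiagonals matter; the rest follow by transitivity. -/
theorem forall_boxLT_iff (hr : r ≤ 1) (hc : c ≤ 1) (x : StripIndex r c m → ℝ) :
    (∀ i j, boxLT (stripBox r c m i) (stripBox r c m j) → x i < x j) ↔
      (∀ a, x (.inr (.inl a)) < x (.inl (lowerFst a)) ∧
        x (.inr (.inl a)) < x (.inl (lowerSnd a))) ∧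
      ∀ i : Fin m, x (.inl i.castSucc) < x (.inr (.inr i)) ∧
        x (.inl i.succ) < x (.inr (.inr i)) := by
  constructor
  · refine fun h => ⟨fun a => ⟨h _ _ ?_, h _ _ ?_⟩, fun i => ⟨h _ _ ?_, h _ _ ?_⟩⟩
    · rcases a with i | i | i <;> simp [boxLT, stripBox, lowerFst] <;> omega
    · rcases a with i | i | i <;> simp [boxLT, stripBox, lowerSnd] <;> omega
    · simp [boxLT, stripBox]
    · simp [boxLT, stripBox]; omega
  · rintro ⟨hA, hC⟩
    have hAB (a) (j : Fin (m + 1)) (h : boxLT (stripBox r c m (.inr (.inl a)))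
        (stripBox r c m (.inl j))) : x (.inr (.inl a)) < x (.inl j) := by
      have : j = lowerFst a ∨ j = lowerSnd a := by
        rcases a with i | i | i <;> simp only [boxLT, stripBox] at h <;>
          simp only [lowerFst, lowerSnd, Sum.elim_inl, Sum.elim_inr, Fin.ext_iff, Fin.val_castSucc,
            Fin.val_succ, Fin.val_zero, Fin.val_last] <;> omega
      rcases this with rfl | rfl
      exacts [(hA a).1, (hA a).2]
    have hBC (j : Fin (m + 1)) (i : Fin m) (h : boxLT (stripBox r c m (.inl j))
        (stripBox r c m (.inr (.inr i)))) : x (.inl j) < x (.inr (.inr i)) := by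
      have : j = i.castSucc ∨ j = i.succ := by
        simp only [boxLT, stripBox] at h
        simp only [Fin.ext_iff, Fin.val_castSucc, Fin.val_succ]
        omega
      rcases this with rfl | rfl
      exacts [(hC i).1, (hC i).2]
    intro i j h
    rcases i with i | i | i <;> rcases j with j | j | j
    · exfalso; simp only [boxLT, stripBox] at h; omega
    · exfalso
      rcases j with j | j | j <;> simp only [boxLT, stripBox] at h <;> omega
    · exact hBC i j h
    · exact hAB i j h
    · exfalso
      rcases i with i | i | i <;> rcases j with j | j | j <;> simp only [boxLT, stripBox] at h <;> omega
    -- A lower and an upper box in one row or column are two apart, and the box between them is a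
    -- middle box adjacent to both.
    · have h' : j.castSucc = lowerFst i ∨ j.castSucc = lowerSnd i ∨ j.succ = lowerFst i := by
        rcases i with i | i | i <;> simp only [boxLT, stripBox] at h <;>
          simp only [lowerFst, lowerSnd, Sum.elim_inl, Sum.elim_inr, Fin.ext_iff, Fin.val_castSucc,
            Fin.val_succ, Fin.val_zero, Fin.val_last] <;> omega
      rcases h' with h' | h' | h'
      · exact ((hA i).1.trans_eq (by rw [h'])).trans (hC j).1
      · exact ((hA i).2.trans_eq (by rw [h'])).trans (hC j).1
      · exact ((hA i).1.trans_eq (by rw [h'])).trans (hC j).2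
    · exfalso; simp only [boxLT, stripBox] at h; omega
    · exfalso
      rcases j with j | j | j <;> simp only [boxLT, stripBox] at h <;> omega
    · exfalso; simp only [boxLT, stripBox] at h; omega

theorem numTableaux_eq_greenMoment (hr : r ≤ 1) (hc : c ≤ 1) (hS : IsStrip S r c m) :
    (numTableaux S : ℝ) = (3 * m + 1 + r + c).factorial *
      greenMoment (Polynomial.X ^ c) (Polynomial.X ^ r) m := by
  have hcard : Fintype.card (StripIndex r c m) = 3 * m + 1 + r + c := by
    simp only [StripIndex, Fintype.card_sum, Fintype.card_fin]
    ring
  have hcells : Fintype.card (StripIndex r c m) =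
      Fintype.card (Finset.Icc 1 S.cells.card) := by
    rw [Fintype.card_congr (stripEquiv hr hc hS)]
    simp
  have h := pi_setOf_coord_lt unitMeasure hcells
    fun i j => boxLT (stripBox r c m i) (stripBox r c m j)
  simp only [forall_boxLT_iff hr hc] at h
  rw [pi_setOf_levels, hcard] at h
  -- End boxes have equal neighbours and give the powers `r` and `c`; the other lower factors pair
  -- with the upper ones into kernels.
  have hint (b : Fin (m + 1) → ℝ) :
      (∏ a : Fin m ⊕ (Fin r ⊕ Fin c),
          unitMeasure (Set.Iio (min (b (lowerFst a)) (b (lowerSnd a))))) *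
        ∏ i : Fin m, unitMeasure (Set.Ioi (max (b i.castSucc) (b i.succ))) =
      unitMeasure (Set.Iio (b 0)) ^ r * (∏ i : Fin m, greenKernel (b i.castSucc) (b i.succ)) *
        unitMeasure (Set.Iio (b (Fin.last m))) ^ c := by
    simp only [Fintype.prod_sum_type, lowerFst, lowerSnd, Sum.elim_inl, Sum.elim_inr, min_self,
      Finset.prod_const, Finset.card_univ, Fintype.card_fin, greenKernel, Finset.prod_mul_distrib]
    ring
  simp only [hint] at h
  rw [lintegral_chain_eq_greenMoment] at h
  rw [numTableaux_eq_card S (stripEquiv hr hc hS)]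
  have h' := congrArg ENNReal.toReal h
  rwa [ENNReal.toReal_mul, ENNReal.toReal_ofReal (greenMoment_X_pow_nonneg r c m),
    ENNReal.toReal_natCast, ENNReal.toReal_natCast] at h'

end

/-! ### The shapes σ and τ as strips, and the recurrences. -/

theorem SkewShape.mem_cells (S : SkewShape) (p : ℕ × ℕ) :
    p ∈ S.cells ↔ p ∈ S.outer ∧ p ∉ S.inner := by
  simp [SkewShape.cells]

theorem isStrip_sigmaSubTwo (m : ℕ) : IsStrip (sigmaSubTwo (m + 1)) 0 0 m := by
  rintro ⟨x, y⟩
  rw [SkewShape.mem_cells, sigmaSubTwo, YoungDiagram.mem_ofRowLens, YoungDiagram.mem_ofRowLens]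
  rcases x with _ | x <;>
  · simp only [List.length_cons, length_descending, List.getElem_cons_zero,
      List.getElem_cons_succ, getElem_descending, exists_prop]
    omega

theorem isStrip_sigmaSubOne (m : ℕ) : IsStrip (sigmaSubOne (m + 1)) 1 0 m := by
  rintro ⟨x, y⟩
  rw [SkewShape.mem_cells, sigmaSubOne, YoungDiagram.mem_ofRowLens, YoungDiagram.mem_ofRowLens]
  rcases x with _ | _ | x <;>
  · simp only [List.length_cons, length_descending, List.getElem_cons_zero,
      List.getElem_cons_succ, getElem_descending, exists_prop]
    omega

theorem isStrip_tauShape (m : ℕ) : IsStrip (tauShape (m + 1)) 1 1 m := by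
  rintro ⟨x, y⟩
  rw [SkewShape.mem_cells, tauShape, YoungDiagram.mem_ofRowLens, YoungDiagram.mem_ofRowLens]
  rcases x with _ | _ | x <;>
  · simp only [List.length_cons, length_descending, List.getElem_cons_zero,
      List.getElem_cons_succ, getElem_descending, exists_prop]
    omega

theorem numTableaux_sigmaSubTwo (m : ℕ) :
    (numTableaux (sigmaSubTwo (m + 1)) : ℝ) = (3 * m + 1).factorial * greenMoment 1 1 m := by
  simpa using numTableaux_eq_greenMoment zero_le_one zero_le_one (isStrip_sigmaSubTwo m)

theorem numTableaux_sigmaSubOne (m : ℕ) :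
    (numTableaux (sigmaSubOne (m + 1)) : ℝ) =
      (3 * m + 2).factorial * greenMoment 1 Polynomial.X m := by
  simpa using numTableaux_eq_greenMoment le_rfl zero_le_one (isStrip_sigmaSubOne m)

theorem numTableaux_tauShape (m : ℕ) :
    (numTableaux (tauShape (m + 1)) : ℝ) =
      (3 * m + 3).factorial * greenMoment Polynomial.X Polynomial.X m := by
  simpa using numTableaux_eq_greenMoment le_rfl le_rfl (isStrip_tauShape m)

/-- The binomial cancels both factorials and leaves `N.factorial`. The parameter `d` is 1 for σ and
0 for τ; `d ≤ 1` keeps the truncated subtractions exact. -/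
theorem sum_Icc_choose_mul_eq (F : ℕ → ℕ) (g : ℕ → ℝ) (d N m : ℕ)
    (hF : ∀ j, (F (j + 1) : ℝ) = (3 * j + 3 - d).factorial * g j) (hd : d ≤ 1)
    (hN : N = 3 * m + 6 - 2 * d) :
    ∑ i ∈ Finset.Icc 1 (m + 1), (N.choose (3 * i - d) : ℝ) * F i * F (m + 2 - i) =
      N.factorial * ∑ a ∈ Finset.HasAntidiagonal.antidiagonal m, g a.1 * g a.2 := by
  rw [Finset.Nat.sum_antidiagonal_eq_sum_range_succ fun i j => g i * g j, Finset.mul_sum,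
    Finset.range_eq_Ico, ← Finset.Ico_add_one_right_eq_Icc,
    Finset.sum_Ico_add' (fun i => (N.choose (3 * i - d) : ℝ) * F i * F (m + 2 - i)) 0 (m + 1) 1
      |>.symm]
  refine Finset.sum_congr rfl fun j hj => ?_
  obtain ⟨l, rfl⟩ : ∃ l, m = j + l := ⟨m - j, by have := (Finset.mem_Ico.1 hj).2; omega⟩
  have hN' : 3 * j + 3 - d ≤ N := by omega
  rw [show j + l + 2 - (j + 1) = l + 1 by omega, hF, hF, show j + l - j = l by omega,
    show 3 * (j + 1) - d = 3 * j + 3 - d by omega, ← Nat.choose_mul_factorial_mul_factorial hN',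
    show N - (3 * j + 3 - d) = 3 * l + 3 - d by omega]
  push_cast
  ring

theorem theorem2 (n : ℕ) (hn : 2 ≤ n) :
    (numTableaux (sigmaSubTwo n) : ℚ) =
        1 / (2 * (n : ℚ) - 1) *
          ∑ i ∈ Finset.Icc 1 (n - 1),
            (Nat.choose (3 * n - 2) (3 * i - 1) : ℚ) *
              (numTableaux (sigmaSubOne i) : ℚ) * (numTableaux (sigmaSubOne (n - i)) : ℚ) ∧
      (numTableaux (tauShape n) : ℚ) =
        1 / (2 * (n : ℚ) + 1) *
          ∑ i ∈ Finset.Icc 1 (n - 1),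
            (Nat.choose (3 * n) (3 * i) : ℚ) *
              (numTableaux (tauShape i) : ℚ) * (numTableaux (tauShape (n - i)) : ℚ) := by
  -- With n = m + 2, the denominators 2n - 1 and 2n + 1 are the factors 2m + 3 and 2m + 5 of the
  -- moment recurrences.
  obtain ⟨m, rfl⟩ := Nat.exists_eq_add_of_le' hn
  rw [show m + 2 - 1 = m + 1 by omega]
  constructor
  · rw [← Rat.cast_inj (α := ℝ)]
    push_cast
    rw [sum_Icc_choose_mul_eq (fun i => numTableaux (sigmaSubOne i)) _ 1 (3 * (m + 2) - 2) m
      (fun j => numTableaux_sigmaSubOne j) le_rfl (by omega), ← greenMoment_one_one_recurrence,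
      show m + 2 = m + 1 + 1 by ring, numTableaux_sigmaSubTwo,
      show 3 * (m + 1 + 1) - 2 = 3 * (m + 1) + 1 by omega]
    have : (2 * ((m : ℝ) + 2) - 1) ≠ 0 := by
      have : (0 : ℝ) ≤ m := Nat.cast_nonneg m
      linarith
    field_simp
    ring
  · rw [← Rat.cast_inj (α := ℝ)]
    push_cast
    have h := sum_Icc_choose_mul_eq (fun i => numTableaux (tauShape i)) _ 0 (3 * (m + 2)) m
      (fun j => numTableaux_tauShape j) zero_le_one (by omega)
    simp only [Nat.sub_zero] at h
    rw [h, ← greenMoment_X_X_recurrence, show m + 2 = m + 1 + 1 by ring, numTableaux_tauShape,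
      show 3 * (m + 1 + 1) = 3 * (m + 1) + 3 by omega]
    have : (2 * ((m : ℝ) + 2) + 1) ≠ 0 := by positivity
    field_simp
    ring
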